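/- Let $\mathcal H$ be a real Hilbert space, let $f:\mathcal H\to\mathbb R\cup\{+\infty\}$ be proper, convex and lower semicontinuous, and let $g:\mathcal H\to\mathbb R$ be convex and Fréchet differentiable with $\frac1\beta$-Lipschitz continuous gradient, where $\beta>0$. Assume that $\operatorname{argmin}_{x\in\mathcal H}\{f(x)+g(x)\}\neq\emptyset$, and let $\gamma\in(0,2\beta]$. For a function $h:\mathcal H\to\mathbb R\cup\{+\infty\}$ write $\operatorname{prox}_{h}(v)=\operatorname{argmin}_{y\in\mathcal H}\{h(y)+\frac12\|y-v\|^2\}$. Let $(\lambda_n)_{n\ge0}$ and $(\beta_n)_{n\ge0}$ be real sequences such that (i) $0<\beta_n\le1$ for all $n\ge0$, $\lim_{n\to\infty}\beta_n=1$, $\sum_{n\ge0}(1-\beta_n)=+\infty$ and $\sum_{n\ge1}|\beta_n-\beta_{n-1}|<+\infty$; (ii) $0<\lambda_n\le\frac{4\beta-\gamma}{2\beta}$ for all $n\ge0$, $\liminf_{n\to\infty}\lambda_n>0$ and $\sum_{n\ge1}|\lambda_n-\lambda_{n-1}|<+\infty$. Then $\operatorname{prox}_{\gamma f}$ is well defined,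 that is, $y\mapsto\gamma f(y)+\frac12\|y-v\|^2$ has exactly one minimizer for every $v\in\mathcal H$; and for every starting point $x_0\in\mathcal H$ the sequence defined by $$x_{n+1}=(1-\lambda_n)\beta_nx_n+\lambda_n\operatorname{prox}_{\gamma f}\big(\beta_nx_n-\gamma\nabla g(\beta_nx_n)\big)\qquad\text{for all } n\ge0$$ converges in norm to the unique minimizer of $f+g$ of smallest norm. -/

import Mathlib

open Filter Topology

namespace TikhonovFB

/-- `f : H → ℝ ∪ {+∞}` (modelled inside `EReal`) is proper: it never takes the value `-∞`
and is finite somewhere. -/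
def IsProper {H : Type*} (f : H → EReal) : Prop :=
  (∀ x, f x ≠ ⊥) ∧ ∃ x, f x ≠ ⊤

/-- Convexity of an extended-real-valued function. It is only used for functions that never take
the value `-∞`, so that the right-hand side is never of the form `∞ - ∞`. -/
def IsConvex {H : Type*} [AddCommGroup H] [Module ℝ H] (f : H → EReal) : Prop :=
  ∀ x y : H, ∀ s t : ℝ, 0 < s → 0 < t → s + t = 1 →
    f (s • x + t • y) ≤ (s : EReal) * f x + (t : EReal) * f y

/-- The set of global minimizers of an extended-real-valued function. -/
def argmin {H : Type*} (h : H → EReal) : Set H :=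
  {x | ∀ y, h x ≤ h y}

/-- The objective `y ↦ f y + ½ ‖y - x‖²` that defines the proximal point of `f` at `x`. -/
noncomputable def proxObjective {H : Type*} [NormedAddCommGroup H] (f : H → EReal) (x : H) :
    H → EReal :=
  fun y => f y + (((1 / 2 : ℝ) * ‖y - x‖ ^ 2 : ℝ) : EReal)

/-- The proximal operator: `prox f x` is the minimizer of `y ↦ f y + ½ ‖y - x‖²`. -/
noncomputable def prox {H : Type*} [NormedAddCommGroup H] (f : H → EReal) (x : H) : H :=
  Classical.epsilon fun p => p ∈ argmin (proxObjective f x)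

end TikhonovFB

/-!
Let `T = prox_{γf} ∘ (I - γ∇g)` be the forward-backward operator. By Fermat's rule its fixed points
are the minimizers of `f + g`. Monotonicity of the subdifferential together with the Baillon–Haddad
theorem makes the over-relaxation `R = (1 - κ) I + κ T` with `κ = (4β - γ) / (2β)` nonexpansive, and
the iteration reads `x (n + 1) = (1 - μ n) y n + μ n R (y n)` with `y n = b n • x n` and
`μ n = lam n / κ ∈ [0, 1]`. Bounded variation of the parameters and Xu's lemma give
`x (n + 1) - x n → 0`, hence `y n - R (y n) → 0`.

The limit is found on the Tikhonov path `R w_t = (1 + t) w_t`: as `t` decreases to `0`, `‖w_t‖`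
increases and stays bounded by the norm of any fixed point, so `w_t` converges strongly to the
fixed point `w` of minimal norm. Testing monotonicity of `I - R` at `w_t` and `y n` shows
`limsup ⟪w, w - y n⟫ ≤ 0`, and Xu's lemma, applied to `‖x n - w‖ ^ 2`, gives `x n → w`.
-/

open scoped RealInnerProductSpace Gradient

namespace TikhonovFB

section RecursiveInequality

theorem tendsto_sum_range_shift {θ : ℕ → ℝ}
    (hθ : Tendsto (fun N => ∑ n ∈ Finset.range N, θ n) atTop atTop) (k : ℕ) :
    Tendsto (fun N => ∑ n ∈ Finset.range N, θ (n + k)) atTop atTop := by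
  refine (tendsto_atTop_add_const_right _ (-∑ n ∈ Finset.range k, θ n)
    (hθ.comp (tendsto_add_atTop_nat k))).congr fun N => ?_
  simp only [Function.comp_apply, Finset.sum_range_add, add_comm _ k]
  ring

theorem le_add_sum_add_mul_exp_of_recursive_le {a θ ε : ℕ → ℝ} {e : ℝ} (ha₀ : 0 ≤ a 0)
    (he : 0 ≤ e) (hθ : ∀ n, θ n ∈ Set.Icc 0 1) (hε : ∀ n, 0 ≤ ε n)
    (hrec : ∀ n, a (n + 1) ≤ (1 - θ n) * a n + θ n * e + ε n) (n : ℕ) :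
    a n ≤ e + ∑ k ∈ Finset.range n, ε k + a 0 * Real.exp (-∑ k ∈ Finset.range n, θ k) := by
  induction n with
  | zero => simpa using he
  | succ n ih =>
    set S := ∑ k ∈ Finset.range n, ε k
    set E := Real.exp (-∑ k ∈ Finset.range n, θ k)
    obtain ⟨hθ₀, hθ₁⟩ := hθ n
    have hS : 0 ≤ S := Finset.sum_nonneg fun k _ => hε k
    have hexp : 1 - θ n ≤ Real.exp (-θ n) := Real.one_sub_le_exp_neg (θ n)
    rw [Finset.sum_range_succ, Finset.sum_range_succ, neg_add, Real.exp_add]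
    calc a (n + 1) ≤ (1 - θ n) * a n + θ n * e + ε n := hrec n
      _ ≤ (1 - θ n) * (e + S + a 0 * E) + θ n * e + ε n := by
          gcongr
      _ = e + (S + ε n) + a 0 * (E * (1 - θ n)) - θ n * S := by ring
      _ ≤ e + (S + ε n) + a 0 * (E * (1 - θ n)) := sub_le_self _ (mul_nonneg hθ₀ hS)
      _ ≤ e + (S + ε n) + a 0 * (E * Real.exp (-θ n)) := by gcongr

/-- Xu's lemma; the hypothesis on `δ` says `limsup δ ≤ 0`. -/
theorem tendsto_zero_of_recursive_le {a θ δ ε : ℕ → ℝ} (ha : ∀ n, 0 ≤ a n)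
    (hθ : ∀ n, θ n ∈ Set.Icc 0 1)
    (hθdiv : Tendsto (fun N => ∑ n ∈ Finset.range N, θ n) atTop atTop)
    (hδ : ∀ e > 0, ∀ᶠ n in atTop, δ n ≤ e) (hε₀ : ∀ n, 0 ≤ ε n) (hε : Summable ε)
    (hrec : ∀ n, a (n + 1) ≤ (1 - θ n) * a n + θ n * δ n + ε n) :
    Tendsto a atTop (𝓝 0) := by
  refine tendsto_order.2 ⟨fun c hc => .of_forall fun n => hc.trans_le (ha n), fun e he => ?_⟩
  have htail : ∀ᶠ N in atTop, ∑' k, ε (k + N) < e / 3 :=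
    (tendsto_sum_nat_add ε).eventually_lt_const (by positivity)
  obtain ⟨N, hδN, hεN⟩ :=
    ((eventually_forall_ge_atTop.2 (hδ (e / 3) (by positivity))).and htail).exists
  have hbound (n : ℕ) : a (n + N) ≤ e / 3 + ∑ k ∈ Finset.range n, ε (k + N) +
      a N * Real.exp (-∑ k ∈ Finset.range n, θ (k + N)) := by
    have hrecN (n : ℕ) : a (n + 1 + N) ≤
        (1 - θ (n + N)) * a (n + N) + θ (n + N) * (e / 3) + ε (n + N) := by
      rw [add_right_comm]
      refine (hrec (n + N)).trans ?_
      gcongr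
      exacts [(hθ _).1, hδN _ (Nat.le_add_left N n)]
    simpa using le_add_sum_add_mul_exp_of_recursive_le (a := fun n => a (n + N)) (ha _)
      (by positivity) (fun n => hθ (n + N)) (fun n => hε₀ (n + N)) hrecN n
  have hexp : Tendsto (fun n => a N * Real.exp (-∑ k ∈ Finset.range n, θ (k + N)))
      atTop (𝓝 0) := by
    simpa using (Real.tendsto_exp_neg_atTop_nhds_zero.comp
      (tendsto_sum_range_shift hθdiv N)).const_mul (a N)
  suffices ∀ᶠ n in atTop, a (n + N) < e by
    rwa [← map_add_atTop_eq_nat N, eventually_map]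
  filter_upwards [hexp.eventually_lt_const (show (0 : ℝ) < e / 3 by positivity)] with n hn
  have hsum : ∑ k ∈ Finset.range n, ε (k + N) ≤ ∑' k, ε (k + N) :=
    ((summable_nat_add_iff N).2 hε).sum_le_tsum _ fun k _ => hε₀ _
  linarith [hbound n]

end RecursiveInequality

section Relaxation

variable {E : Type*} [NormedAddCommGroup E]

theorem norm_sub_le_of_lipschitzWith_one {R : E → E} (hR : LipschitzWith 1 R) (u v : E) :
    ‖R u - R v‖ ≤ ‖u - v‖ := by
  simpa [dist_eq_norm] using hR.dist_le_mul u v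

theorem norm_image_sub_le_two_mul {R : E → E} (hR : LipschitzWith 1 R) {p : E}
    (hp : Function.IsFixedPt R p) (u : E) : ‖R u - u‖ ≤ 2 * ‖u - p‖ := by
  have h := norm_sub_le_of_lipschitzWith_one hR u p
  rw [hp.eq] at h
  linarith [norm_sub_le_norm_sub_add_norm_sub (R u) p u, norm_sub_rev p u]

theorem cauchySeq_of_norm_sub_sq_le {w : ℕ → E} {C : ℝ} (hC : ∀ n, ‖w n‖ ≤ C)
    (h : ∀ m n, m ≤ n → ‖w n - w m‖ ^ 2 ≤ ‖w n‖ ^ 2 - ‖w m‖ ^ 2) : CauchySeq w := by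
  have hmono : Monotone fun n => ‖w n‖ ^ 2 := fun m n hmn => by
    linarith [h m n hmn, sq_nonneg ‖w n - w m‖]
  have hbdd : BddAbove (Set.range fun n => ‖w n‖ ^ 2) :=
    ⟨C ^ 2, Set.forall_mem_range.2 fun n => pow_le_pow_left₀ (norm_nonneg _) (hC n) 2⟩
  set L := ⨆ n, ‖w n‖ ^ 2
  refine cauchySeq_of_le_tendsto_0' (fun m => √(L - ‖w m‖ ^ 2)) (fun m n hmn => ?_) ?_
  · rw [dist_comm, dist_eq_norm]
    exact Real.le_sqrt_of_sq_le ((h m n hmn).trans (sub_le_sub_right (le_ciSup hbdd n) _))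
  · simpa only [L, sub_self, Real.sqrt_zero] using
      ((tendsto_atTop_ciSup hmono hbdd).const_sub L).sqrt

variable [NormedSpace ℝ E]

/-- The relaxation `(1 - κ) I + κ T` of an operator `T`. Over-relaxations `κ > 1` are allowed, so
that `LipschitzWith 1 (relax κ T)` says that `T` is `κ⁻¹`-averaged. -/
def relax (κ : ℝ) (T : E → E) (u : E) : E := u + κ • (T u - u)

theorem isFixedPt_relax_iff {κ : ℝ} (hκ : κ ≠ 0) {T : E → E} {p : E} :
    Function.IsFixedPt (relax κ T) p ↔ Function.IsFixedPt T p := by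
  simp only [Function.IsFixedPt, relax, add_eq_left, smul_eq_zero_iff_right hκ, sub_eq_zero]

theorem relax_relax (κ μ : ℝ) (T : E → E) : relax μ (relax κ T) = relax (μ * κ) T := by
  ext u
  simp only [relax, add_sub_cancel_left, smul_smul]

theorem norm_relax_sub_relax_le {R : E → E} (hR : LipschitzWith 1 R) {μ : ℝ}
    (hμ : μ ∈ Set.Icc 0 1) (ν : ℝ) (u v : E) :
    ‖relax μ R u - relax ν R v‖ ≤ ‖u - v‖ + |μ - ν| * ‖R v - v‖ := by
  have hsplit : relax μ R u - relax ν R v =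
      ((1 - μ) • (u - v) + μ • (R u - R v)) + (μ - ν) • (R v - v) := by
    simp only [relax]; module
  calc ‖relax μ R u - relax ν R v‖
      ≤ ‖(1 - μ) • (u - v)‖ + ‖μ • (R u - R v)‖ + ‖(μ - ν) • (R v - v)‖ := by
        rw [hsplit]; exact norm_add₃_le
    _ = (1 - μ) * ‖u - v‖ + μ * ‖R u - R v‖ + |μ - ν| * ‖R v - v‖ := by
        rw [norm_smul_of_nonneg (sub_nonneg.2 hμ.2), norm_smul_of_nonneg hμ.1, norm_smul,
          Real.norm_eq_abs]
    _ ≤ (1 - μ) * ‖u - v‖ + μ * ‖u - v‖ + |μ - ν| * ‖R v - v‖ := by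
        gcongr
        exacts [hμ.1, norm_sub_le_of_lipschitzWith_one hR u v]
    _ = ‖u - v‖ + |μ - ν| * ‖R v - v‖ := by ring

theorem norm_relax_sub_le {R : E → E} (hR : LipschitzWith 1 R) {μ : ℝ} (hμ : μ ∈ Set.Icc 0 1)
    {w : E} (hw : Function.IsFixedPt R w) (u : E) : ‖relax μ R u - w‖ ≤ ‖u - w‖ := by
  have hw' : relax μ R w = w := by simp [relax, hw.eq]
  simpa [hw'] using norm_relax_sub_relax_le hR hμ μ u w

theorem norm_smul_sub_smul_le {s : ℝ} (hs : 0 ≤ s) (t : ℝ) (u v : E) :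
    ‖s • u - t • v‖ ≤ s * ‖u - v‖ + |s - t| * ‖v‖ := by
  calc ‖s • u - t • v‖ = ‖s • (u - v) + (s - t) • v‖ := by congr 1; module
    _ ≤ ‖s • (u - v)‖ + ‖(s - t) • v‖ := norm_add_le _ _
    _ = s * ‖u - v‖ + |s - t| * ‖v‖ := by
        rw [norm_smul_of_nonneg hs, norm_smul, Real.norm_eq_abs]

end Relaxation

section TikhonovPath

variable {H : Type*} [NormedAddCommGroup H] [InnerProductSpace ℝ H]

theorem inner_sub_image_nonneg {R : H → H} (hR : LipschitzWith 1 R) (u v : H) :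
    0 ≤ ⟪(u - R u) - (v - R v), u - v⟫ := by
  rw [sub_sub_sub_comm, inner_sub_left, real_inner_self_eq_norm_sq, sub_nonneg, sq]
  exact (real_inner_le_norm _ _).trans <|
    mul_le_mul_of_nonneg_right (norm_sub_le_of_lipschitzWith_one hR u v) (norm_nonneg _)

theorem mul_inner_regularized_le {R : H → H} (hR : LipschitzWith 1 R) {t : ℝ} {w : H}
    (hw : R w = (1 + t) • w) (y : H) : t * ⟪w, w - y⟫ ≤ ⟪y - R y, y - w⟫ := by
  have h := inner_sub_image_nonneg hR w y
  have hres : w - R w = -(t • w) := by rw [hw]; module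
  rw [hres, inner_sub_left, inner_neg_left, real_inner_smul_left] at h
  rw [← neg_sub w y, inner_neg_right]
  linarith

theorem inner_sub_nonpos_of_regularized {R : H → H} (hR : LipschitzWith 1 R) {s t : ℝ}
    (hs : 0 ≤ s) (hst : s < t) {v w : H} (hv : R v = (1 + s) • v) (hw : R w = (1 + t) • w) :
    ⟪w, w - v⟫ ≤ 0 := by
  have h := mul_inner_regularized_le hR hw v
  have hv' : v - R v = -(s • v) := by rw [hv]; module
  have hinner : ⟪v - R v, v - w⟫ = s * (⟪w, w - v⟫ - ‖w - v‖ ^ 2) := by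
    rw [hv', ← real_inner_self_eq_norm_sq, ← inner_sub_left, inner_neg_left, real_inner_smul_left,
      ← neg_sub w v, inner_neg_right, sub_sub_cancel]
    ring
  rw [hinner] at h
  have : (t - s) * ⟪w, w - v⟫ ≤ 0 := by nlinarith [mul_nonneg hs (sq_nonneg ‖w - v‖)]
  exact nonpos_of_mul_nonpos_right this (sub_pos.2 hst)

theorem norm_sub_sq_le_of_inner_sub_nonpos {u v : H} (h : ⟪u, u - v⟫ ≤ 0) :
    ‖v - u‖ ^ 2 ≤ ‖v‖ ^ 2 - ‖u‖ ^ 2 := by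
  rw [inner_sub_right, real_inner_self_eq_norm_sq] at h
  rw [norm_sub_sq_real, real_inner_comm]
  linarith

theorem norm_lt_norm_of_inner_sub_nonpos {u v : H} (h : ⟪u, u - v⟫ ≤ 0) (hne : v ≠ u) :
    ‖u‖ < ‖v‖ := by
  have hpos : 0 < ‖v - u‖ ^ 2 := pow_pos (norm_sub_pos_iff.2 hne) 2
  exact lt_of_pow_lt_pow_left₀ 2 (norm_nonneg v)
    (by linarith [norm_sub_sq_le_of_inner_sub_nonpos h])

theorem isFixedPt_of_tendsto_regularized {R : H → H} (hR : Continuous R) {t : ℕ → ℝ}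
    (ht : Tendsto t atTop (𝓝 0)) {w : ℕ → H} {z : H} (hw : ∀ k, R (w k) = (1 + t k) • w k)
    (hz : Tendsto w atTop (𝓝 z)) : Function.IsFixedPt R z := by
  have hlim : Tendsto (fun k => R (w k)) atTop (𝓝 z) := by
    simpa [hw] using (ht.const_add 1).smul hz
  exact tendsto_nhds_unique ((hR.tendsto z).comp hz) hlim

theorem inner_sub_self_le_add (z w y : H) :
    ⟪z, z - y⟫ ≤ ⟪w, w - y⟫ + ‖z - w‖ * (‖z‖ + ‖y‖ + ‖w‖) := by
  have hsplit : ⟪z, z - y⟫ = ⟪w, w - y⟫ + (⟪z - w, z - y⟫ + ⟪z - w, w⟫) := by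
    rw [real_inner_comm w (z - w)]
    simp only [inner_sub_left, inner_sub_right]
    ring
  have hzy : ⟪z - w, z - y⟫ ≤ ‖z - w‖ * (‖z‖ + ‖y‖) :=
    (real_inner_le_norm _ _).trans (by gcongr; exact norm_sub_le z y)
  linarith [real_inner_le_norm (z - w) w]

theorem eventually_inner_sub_le_of_tendsto_regularized {R : H → H} (hR : LipschitzWith 1 R)
    {t : ℕ → ℝ} (ht : ∀ k, 0 < t k) {w : ℕ → H} {z : H} (hw : ∀ k, R (w k) = (1 + t k) • w k)
    (hz : Tendsto w atTop (𝓝 z)) {y : ℕ → H} {C : ℝ} (hC : ∀ n, ‖y n‖ ≤ C)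
    (hy : Tendsto (fun n => ‖y n - R (y n)‖) atTop (𝓝 0)) {e : ℝ} (he : 0 < e) :
    ∀ᶠ n in atTop, ⟪z, z - y n⟫ ≤ e := by
  have hpath : Tendsto (fun k => ‖z - w k‖ * (‖z‖ + C + ‖w k‖)) atTop (𝓝 0) := by
    simpa using (hz.const_sub z).norm.mul (hz.norm.const_add (‖z‖ + C))
  obtain ⟨k, hk⟩ := (hpath.eventually_lt_const (half_pos he)).exists
  have hresidual : Tendsto (fun n => ‖y n - R (y n)‖ * (C + ‖w k‖)) atTop (𝓝 0) := by
    simpa using hy.mul_const (C + ‖w k‖)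
  filter_upwards [hresidual.eventually_lt_const (mul_pos (ht k) (half_pos he))] with n hn
  have hwk : ⟪w k, w k - y n⟫ ≤ e / 2 := by
    refine le_of_mul_le_mul_left ?_ (ht k)
    calc t k * ⟪w k, w k - y n⟫ ≤ ⟪y n - R (y n), y n - w k⟫ :=
          mul_inner_regularized_le hR (hw k) (y n)
      _ ≤ ‖y n - R (y n)‖ * ‖y n - w k‖ := real_inner_le_norm _ _
      _ ≤ ‖y n - R (y n)‖ * (C + ‖w k‖) := by
          gcongr
          exact (norm_sub_le _ _).trans (by gcongr; exact hC n)
      _ ≤ t k * (e / 2) := hn.le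
  calc ⟪z, z - y n⟫ ≤ ⟪w k, w k - y n⟫ + ‖z - w k‖ * (‖z‖ + ‖y n‖ + ‖w k‖) :=
        inner_sub_self_le_add z (w k) (y n)
    _ ≤ e / 2 + ‖z - w k‖ * (‖z‖ + C + ‖w k‖) := by gcongr; exact hC n
    _ ≤ e := by linarith

variable [CompleteSpace H]

theorem exists_image_eq_one_add_smul {R : H → H} (hR : LipschitzWith 1 R) {t : ℝ} (ht : 0 < t) :
    ∃ w, R w = (1 + t) • w := by
  have hcontr : ContractingWith (Real.toNNReal (1 + t)⁻¹) fun w => (1 + t)⁻¹ • R w := by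
    refine ⟨?_, LipschitzWith.of_dist_le_mul fun u v => ?_⟩
    · rw [Real.toNNReal_lt_one]
      exact inv_lt_one_of_one_lt₀ (by linarith)
    · rw [dist_eq_norm, dist_eq_norm, ← smul_sub, norm_smul_of_nonneg (by positivity),
        Real.coe_toNNReal _ (by positivity)]
      gcongr
      exact norm_sub_le_of_lipschitzWith_one hR u v
  have hfix : (1 + t)⁻¹ • R hcontr.fixedPoint = hcontr.fixedPoint := hcontr.fixedPoint_isFixedPt
  exact ⟨hcontr.fixedPoint, (inv_smul_eq_iff₀ (by positivity)).1 hfix⟩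

theorem exists_tendsto_regularized {R : H → H} (hR : LipschitzWith 1 R) {p : H}
    (hp : Function.IsFixedPt R p) :
    ∃ (t : ℕ → ℝ) (w : ℕ → H) (z : H), (∀ k, 0 < t k) ∧ Tendsto t atTop (𝓝 0) ∧
      (∀ k, R (w k) = (1 + t k) • w k) ∧ Tendsto w atTop (𝓝 z) := by
  obtain ⟨t, htanti, htpos, htlim⟩ := exists_seq_strictAnti_tendsto (0 : ℝ)
  choose w hw using fun k => exists_image_eq_one_add_smul hR (htpos k)
  have hnorm (k : ℕ) : ‖w k‖ ≤ ‖p‖ := by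
    have hp₀ : R p = (1 + (0 : ℝ)) • p := by simpa using hp.eq
    have h := norm_sub_sq_le_of_inner_sub_nonpos
      (inner_sub_nonpos_of_regularized hR le_rfl (htpos k) hp₀ (hw k))
    exact le_of_sq_le_sq (by linarith [sq_nonneg ‖p - w k‖]) (norm_nonneg p)
  have hcauchy : CauchySeq w := by
    refine cauchySeq_of_norm_sub_sq_le hnorm fun m n hmn => ?_
    rcases hmn.eq_or_lt with rfl | hlt
    · simp
    · exact norm_sub_sq_le_of_inner_sub_nonpos
        (inner_sub_nonpos_of_regularized hR (htpos n).le (htanti hlt) (hw n) (hw m))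
  obtain ⟨z, hz⟩ := cauchySeq_tendsto_of_complete hcauchy
  exact ⟨t, w, z, htpos, htlim, hw, hz⟩

/-- The limit of the Tikhonov path satisfies the variational inequality of the minimal-norm fixed
point, asymptotically along every bounded sequence of approximate fixed points; this replaces the
demiclosedness of `I - R` and weak compactness. -/
theorem exists_isFixedPt_eventually_inner_sub_le {R : H → H} (hR : LipschitzWith 1 R) {p : H}
    (hp : Function.IsFixedPt R p) :
    ∃ w, Function.IsFixedPt R w ∧ ∀ (y : ℕ → H) (C : ℝ), (∀ n, ‖y n‖ ≤ C) →
      Tendsto (fun n => ‖y n - R (y n)‖) atTop (𝓝 0) → ∀ e > 0, ∀ᶠ n in atTop,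
        ⟪w, w - y n⟫ ≤ e := by
  obtain ⟨t, w, z, htpos, htlim, hw, hz⟩ := exists_tendsto_regularized hR hp
  exact ⟨z, isFixedPt_of_tendsto_regularized hR.continuous htlim hw hz, fun _ _ hC hy _ he =>
    eventually_inner_sub_le_of_tendsto_regularized hR htpos hw hz hC hy he⟩

end TikhonovPath

section TikhonovIteration

variable {E : Type*} [NormedAddCommGroup E] [NormedSpace ℝ E] {R : E → E} {b μ : ℕ → ℝ}
  {x : ℕ → E}

theorem norm_sub_le_max_of_tikhonov (hR : LipschitzWith 1 R) {w : E}
    (hw : Function.IsFixedPt R w) (hb : ∀ n, b n ∈ Set.Icc 0 1) (hμ : ∀ n, μ n ∈ Set.Icc 0 1)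
    (hx : ∀ n, x (n + 1) = relax (μ n) R (b n • x n)) (n : ℕ) :
    ‖x n - w‖ ≤ max ‖x 0 - w‖ ‖w‖ := by
  induction n with
  | zero => exact le_max_left _ _
  | succ n ih =>
    set M := max ‖x 0 - w‖ ‖w‖
    calc ‖x (n + 1) - w‖ ≤ ‖b n • x n - w‖ := by
          rw [hx]; exact norm_relax_sub_le hR (hμ n) hw _
      _ ≤ b n * ‖x n - w‖ + (1 - b n) * ‖w‖ := by
          simpa [abs_sub_comm (b n), abs_of_nonneg (sub_nonneg.2 (hb n).2)] using
            norm_smul_sub_smul_le (hb n).1 1 (x n) w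
      _ ≤ b n * M + (1 - b n) * M := by
          gcongr
          exacts [(hb n).1, sub_nonneg.2 (hb n).2, le_max_right _ _]
      _ = M := by ring

theorem exists_norm_le_of_tikhonov (hR : LipschitzWith 1 R) {p : E}
    (hp : Function.IsFixedPt R p) (hb : ∀ n, b n ∈ Set.Icc 0 1) (hμ : ∀ n, μ n ∈ Set.Icc 0 1)
    (hx : ∀ n, x (n + 1) = relax (μ n) R (b n • x n)) : ∃ C, ∀ n, ‖x n‖ ≤ C :=
  ⟨max ‖x 0 - p‖ ‖p‖ + ‖p‖, fun n => (norm_le_norm_sub_add (x n) p).trans <| by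
    gcongr; exact norm_sub_le_max_of_tikhonov hR hp hb hμ hx n⟩

theorem norm_smul_le_of_mem_Icc {s : ℝ} (hs : s ∈ Set.Icc 0 1) (u : E) : ‖s • u‖ ≤ ‖u‖ := by
  rw [norm_smul_of_nonneg hs.1]
  exact mul_le_of_le_one_left (norm_nonneg u) hs.2

theorem tendsto_norm_succ_sub_of_tikhonov (hR : LipschitzWith 1 R) {p : E}
    (hp : Function.IsFixedPt R p) (hb : ∀ n, b n ∈ Set.Icc 0 1)
    (hbdiv : Tendsto (fun N => ∑ n ∈ Finset.range N, (1 - b n)) atTop atTop)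
    (hbvar : Summable fun n => |b (n + 1) - b n|) (hμ : ∀ n, μ n ∈ Set.Icc 0 1)
    (hμvar : Summable fun n => |μ (n + 1) - μ n|)
    (hx : ∀ n, x (n + 1) = relax (μ n) R (b n • x n)) :
    Tendsto (fun n => ‖x (n + 1) - x n‖) atTop (𝓝 0) := by
  obtain ⟨C, hC⟩ := exists_norm_le_of_tikhonov hR hp hb hμ hx
  have hC₀ : 0 ≤ C := (norm_nonneg _).trans (hC 0)
  set D := 2 * (C + ‖p‖)
  have hD (n : ℕ) : ‖R (b n • x n) - b n • x n‖ ≤ D := by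
    refine (norm_image_sub_le_two_mul hR hp _).trans ((mul_le_mul_iff_right₀ two_pos).2 ?_)
    refine (norm_sub_le _ _).trans ?_
    gcongr
    exact (norm_smul_le_of_mem_Icc (hb n) _).trans (hC n)
  have hD₀ : 0 ≤ D := (norm_nonneg _).trans (hD 0)
  refine tendsto_zero_of_recursive_le (θ := fun n => 1 - b (n + 1)) (δ := fun _ => 0)
    (ε := fun n => |b (n + 1) - b n| * C + |μ (n + 1) - μ n| * D) (fun _ => norm_nonneg _)
    (fun n => ⟨sub_nonneg.2 (hb _).2, sub_le_self _ (hb _).1⟩) (tendsto_sum_range_shift hbdiv 1)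
    (fun e he => .of_forall fun _ => he.le)
    (fun n => add_nonneg (mul_nonneg (abs_nonneg _) hC₀) (mul_nonneg (abs_nonneg _) hD₀))
    ((hbvar.mul_right C).add (hμvar.mul_right D)) fun n => ?_
  calc ‖x (n + 1 + 1) - x (n + 1)‖
      ≤ ‖b (n + 1) • x (n + 1) - b n • x n‖
        + |μ (n + 1) - μ n| * ‖R (b n • x n) - b n • x n‖ := by
        rw [hx (n + 1)]
        nth_rw 2 [hx n]
        exact norm_relax_sub_relax_le hR (hμ (n + 1)) (μ n) _ _
    _ ≤ b (n + 1) * ‖x (n + 1) - x n‖ + |b (n + 1) - b n| * ‖x n‖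
        + |μ (n + 1) - μ n| * ‖R (b n • x n) - b n • x n‖ := by
        gcongr
        exact norm_smul_sub_smul_le (hb (n + 1)).1 (b n) _ _
    _ ≤ b (n + 1) * ‖x (n + 1) - x n‖ + |b (n + 1) - b n| * C
        + |μ (n + 1) - μ n| * D := by
        gcongr
        exacts [hC n, hD n]
    _ = (1 - (1 - b (n + 1))) * ‖x (n + 1) - x n‖ + (1 - b (n + 1)) * 0
        + (|b (n + 1) - b n| * C + |μ (n + 1) - μ n| * D) := by ring

theorem tendsto_norm_smul_sub_image_of_tikhonov (hb : ∀ n, b n ≤ 1)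
    (hblim : Tendsto b atTop (𝓝 1)) {δ : ℝ} (hδ : 0 < δ) (hμδ : ∀ᶠ n in atTop, δ ≤ μ n)
    (hx : ∀ n, x (n + 1) = relax (μ n) R (b n • x n)) {C : ℝ} (hC : ∀ n, ‖x n‖ ≤ C)
    (hdiff : Tendsto (fun n => ‖x (n + 1) - x n‖) atTop (𝓝 0)) :
    Tendsto (fun n => ‖b n • x n - R (b n • x n)‖) atTop (𝓝 0) := by
  have hbound : Tendsto (fun n => (‖x (n + 1) - x n‖ + (1 - b n) * C) / δ) atTop (𝓝 0) := by
    simpa using (hdiff.add ((hblim.const_sub 1).mul_const C)).div_const δ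
  refine squeeze_zero' (.of_forall fun _ => norm_nonneg _) ?_ hbound
  filter_upwards [hμδ] with n hn
  have hstep : μ n • (R (b n • x n) - b n • x n) = (x (n + 1) - x n) + (1 - b n) • x n := by
    rw [hx n, relax]; module
  rw [le_div_iff₀ hδ, norm_sub_rev, mul_comm]
  calc δ * ‖R (b n • x n) - b n • x n‖ ≤ μ n * ‖R (b n • x n) - b n • x n‖ := by gcongr
    _ = ‖(x (n + 1) - x n) + (1 - b n) • x n‖ := by
        rw [← hstep, norm_smul_of_nonneg (hδ.le.trans hn)]
    _ ≤ ‖x (n + 1) - x n‖ + ‖(1 - b n) • x n‖ := norm_add_le _ _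
    _ ≤ ‖x (n + 1) - x n‖ + (1 - b n) * C := by
        rw [norm_smul_of_nonneg (sub_nonneg.2 (hb n))]
        gcongr
        exacts [sub_nonneg.2 (hb n), hC n]

end TikhonovIteration

section StrongConvergence

variable {H : Type*} [NormedAddCommGroup H] [InnerProductSpace ℝ H]

theorem norm_smul_sub_sq_le {s : ℝ} (hs : s ∈ Set.Icc 0 1) (u w : H) :
    ‖s • u - w‖ ^ 2 ≤ s * ‖u - w‖ ^ 2 + (1 - s) * (2 * ⟪w, w - s • u⟫) := by
  have hexpand : ‖s • u - w‖ ^ 2 + (1 - s) ^ 2 * ‖w‖ ^ 2 =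
      s ^ 2 * ‖u - w‖ ^ 2 + (1 - s) * (2 * ⟪w, w - s • u⟫) := by
    rw [norm_sub_sq_real, norm_sub_sq_real, norm_smul_of_nonneg hs.1, inner_sub_right,
      real_inner_self_eq_norm_sq, real_inner_smul_left, real_inner_smul_right, real_inner_comm w u]
    ring
  have hsq : s ^ 2 * ‖u - w‖ ^ 2 ≤ s * ‖u - w‖ ^ 2 := by
    gcongr
    exact pow_le_of_le_one hs.1 hs.2 two_ne_zero
  have hw : 0 ≤ (1 - s) ^ 2 * ‖w‖ ^ 2 := by positivity
  linarith

variable [CompleteSpace H] {b μ : ℕ → ℝ} {x : ℕ → H}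

theorem exists_minNorm_isFixedPt_tendsto {R : H → H} (hR : LipschitzWith 1 R) {p : H}
    (hp : Function.IsFixedPt R p) (hb : ∀ n, b n ∈ Set.Icc 0 1) (hblim : Tendsto b atTop (𝓝 1))
    (hbdiv : Tendsto (fun N => ∑ n ∈ Finset.range N, (1 - b n)) atTop atTop)
    (hbvar : Summable fun n => |b (n + 1) - b n|) (hμ : ∀ n, μ n ∈ Set.Icc 0 1) {δ : ℝ}
    (hδ : 0 < δ) (hμδ : ∀ᶠ n in atTop, δ ≤ μ n) (hμvar : Summable fun n => |μ (n + 1) - μ n|)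
    (hx : ∀ n, x (n + 1) = relax (μ n) R (b n • x n)) :
    ∃ w, Function.IsFixedPt R w ∧ (∀ z, Function.IsFixedPt R z → z ≠ w → ‖w‖ < ‖z‖) ∧
      Tendsto x atTop (𝓝 w) := by
  obtain ⟨w, hw, hinner⟩ := exists_isFixedPt_eventually_inner_sub_le hR hp
  refine ⟨w, hw, fun z hz hzw => ?_, ?_⟩
  · have hvar : ⟪w, w - z⟫ ≤ 0 := le_of_forall_gt_imp_ge_of_dense fun e he => by
      simpa using (hinner (fun _ => z) ‖z‖ (fun _ => le_rfl) (by simp [hz.eq]) e he).exists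
    exact norm_lt_norm_of_inner_sub_nonpos hvar hzw
  · obtain ⟨C, hC⟩ := exists_norm_le_of_tikhonov hR hp hb hμ hx
    have hres := tendsto_norm_smul_sub_image_of_tikhonov (fun n => (hb n).2) hblim hδ hμδ hx hC
      (tendsto_norm_succ_sub_of_tikhonov hR hp hb hbdiv hbvar hμ hμvar hx)
    have hinner_le := hinner _ C
      (fun n => (norm_smul_le_of_mem_Icc (hb n) (x n)).trans (hC n)) hres
    have hsq : Tendsto (fun n => ‖x n - w‖ ^ 2) atTop (𝓝 0) := by
      refine tendsto_zero_of_recursive_le (θ := fun n => 1 - b n)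
        (δ := fun n => 2 * ⟪w, w - b n • x n⟫) (ε := fun _ => 0) (fun _ => sq_nonneg _)
        (fun n => ⟨sub_nonneg.2 (hb n).2, sub_le_self _ (hb n).1⟩) hbdiv
        (fun e he => (hinner_le (e / 2) (half_pos he)).mono fun n hn => by linarith)
        (fun _ => le_rfl) summable_zero fun n => ?_
      have hstep : ‖x (n + 1) - w‖ ≤ ‖b n • x n - w‖ := by
        rw [hx]; exact norm_relax_sub_le hR (hμ n) hw _
      rw [sub_sub_cancel, add_zero]
      exact (pow_le_pow_left₀ (norm_nonneg _) hstep 2).trans (norm_smul_sub_sq_le (hb n) (x n) w)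
    rw [tendsto_iff_norm_sub_tendsto_zero]
    simpa [Real.sqrt_sq (norm_nonneg _)] using hsq.sqrt

theorem exists_minNorm_isFixedPt_tendsto_of_averaged {T : H → H} {κ : ℝ}
    (hT : LipschitzWith 1 (relax κ T)) {p : H} (hp : Function.IsFixedPt T p)
    (hb : ∀ n, b n ∈ Set.Icc 0 1) (hblim : Tendsto b atTop (𝓝 1))
    (hbdiv : Tendsto (fun N => ∑ n ∈ Finset.range N, (1 - b n)) atTop atTop)
    (hbvar : Summable fun n => |b (n + 1) - b n|) (hμ : ∀ n, μ n ∈ Set.Icc 0 κ)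
    (hμliminf : 0 < liminf μ atTop) (hμvar : Summable fun n => |μ (n + 1) - μ n|)
    (hx : ∀ n, x (n + 1) = relax (μ n) T (b n • x n)) :
    ∃ w, Function.IsFixedPt T w ∧ (∀ z, Function.IsFixedPt T z → z ≠ w → ‖w‖ < ‖z‖) ∧
      Tendsto x atTop (𝓝 w) := by
  obtain ⟨δ, hδ, hδliminf⟩ := exists_between hμliminf
  have hμδ : ∀ᶠ n in atTop, δ < μ n :=
    eventually_lt_of_lt_liminf hδliminf (isBoundedUnder_of ⟨0, fun n => (hμ n).1⟩)
  have hκ : 0 < κ := by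
    obtain ⟨n, hn⟩ := hμδ.exists
    exact hδ.trans (hn.trans_le (hμ n).2)
  have hfix (z : H) : Function.IsFixedPt (relax κ T) z ↔ Function.IsFixedPt T z :=
    isFixedPt_relax_iff hκ.ne'
  obtain ⟨w, hw, hmin, hlim⟩ := exists_minNorm_isFixedPt_tendsto hT ((hfix p).2 hp) hb hblim hbdiv
    hbvar (μ := fun n => μ n / κ) (x := x)
    (fun n => ⟨div_nonneg (hμ n).1 hκ.le, (div_le_one hκ).2 (hμ n).2⟩) (div_pos hδ hκ)
    (hμδ.mono fun n hn => by gcongr)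
    (by simpa only [← sub_div, abs_div] using hμvar.div_const |κ|)
    (fun n => by rw [relax_relax, div_mul_cancel₀ _ hκ.ne', hx n])
  exact ⟨w, (hfix w).1 hw, fun z hz => hmin z ((hfix z).2 hz), hlim⟩

end StrongConvergence

section ExtendedReal

theorem add_coe_le_coe_iff {a : EReal} {q r : ℝ} : a + q ≤ r ↔ a ≤ ((r - q : ℝ) : EReal) := by
  rw [EReal.coe_sub, EReal.le_sub_iff_add_le (.inl (EReal.coe_ne_bot q))
    (.inl (EReal.coe_ne_top q))]

theorem ne_top_of_add_coe_le {a b : EReal} {q : ℝ} (h : a + q ≤ b) (hb : b ≠ ⊤) : a ≠ ⊤ := by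
  rintro rfl
  exact hb (top_le_iff.1 (by simpa using h))

theorem coe_mul_le_iff {c : ℝ} (hc : 0 < c) {a b : EReal} : c * a ≤ b ↔ a ≤ b / c := by
  rw [mul_comm, EReal.le_div_iff_mul_le (EReal.coe_pos.2 hc) (EReal.coe_ne_top c)]

theorem coe_mul_le_coe_mul_iff {c : ℝ} (hc : 0 < c) {a b : EReal} :
    (c : EReal) * a ≤ c * b ↔ a ≤ b := by
  rw [coe_mul_le_iff hc, ← EReal.mul_div, EReal.mul_div_cancel (EReal.coe_ne_bot c)
    (EReal.coe_ne_top c) (EReal.coe_ne_zero.2 hc.ne')]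

theorem lowerSemicontinuous_coe_mul {X : Type*} [TopologicalSpace X] {F : X → EReal}
    (hF : LowerSemicontinuous F) {c : ℝ} (hc : 0 < c) :
    LowerSemicontinuous fun x => (c : EReal) * F x := by
  rw [lowerSemicontinuous_iff_isClosed_preimage]
  intro r
  simpa only [Set.preimage, Set.mem_Iic, coe_mul_le_iff hc] using hF.isClosed_preimage (r / c)

end ExtendedReal

section ConvexFunction

variable {V : Type*} {F : V → EReal}

theorem IsProper.coe_mul (hF : IsProper F) {c : ℝ} (hc : 0 < c) :
    IsProper fun x => (c : EReal) * F x := by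
  obtain ⟨hbot, x, hx⟩ := hF
  refine ⟨fun y => ?_, x, ?_⟩
  · have := hbot y
    simp [EReal.mul_eq_bot, hc.le, hc, this]
  · simp [EReal.mul_eq_top, hc.le, hc, hx]

variable [AddCommGroup V] [Module ℝ V]

theorem IsConvex.coe_mul (hF : IsConvex F) {c : ℝ} (hc : 0 < c) :
    IsConvex fun x => (c : EReal) * F x := by
  intro x y s t hs ht hst
  calc (c : EReal) * F (s • x + t • y) ≤ c * (s * F x + t * F y) :=
        (coe_mul_le_coe_mul_iff hc).2 (hF x y s t hs ht hst)
    _ = s * (c * F x) + t * (c * F y) := by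
        rw [EReal.left_distrib_of_nonneg_of_ne_top (EReal.coe_nonneg.2 hc.le) (EReal.coe_ne_top c),
          mul_left_comm, mul_left_comm (c : EReal)]

theorem IsConvex.le_coe (hF : IsConvex F) {x y : V} {a b s t : ℝ} (hx : F x ≤ a) (hy : F y ≤ b)
    (hs : 0 < s) (ht : 0 < t) (hst : s + t = 1) :
    F (s • x + t • y) ≤ ((s * a + t * b : ℝ) : EReal) := by
  refine (hF x y s t hs ht hst).trans ?_
  push_cast
  gcongr

end ConvexFunction

section Minimization

variable {X : Type*} [MetricSpace X] [CompleteSpace X] {G : X → EReal} {c : ℝ}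

theorem existsUnique_le_of_dist_sq_le (hlsc : LowerSemicontinuous G) {m : ℝ}
    (hex : ∀ t > 0, ∃ x, G x ≤ ((m + t : ℝ) : EReal))
    (hdist : ∀ (x y : X) (t : ℝ), G x ≤ ((m + t : ℝ) : EReal) → G y ≤ ((m + t : ℝ) : EReal) →
      dist x y ^ 2 ≤ t / c) :
    ∃! p, G p ≤ m := by
  obtain ⟨t, htanti, htpos, htlim⟩ := exists_seq_strictAnti_tendsto (0 : ℝ)
  choose y hy using fun n => hex (t n) (htpos n)
  have hy_le {k n : ℕ} (hkn : k ≤ n) : G (y n) ≤ ((m + t k : ℝ) : EReal) :=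
    (hy n).trans <| EReal.coe_le_coe_iff.2 (add_le_add_right (htanti.antitone hkn) m)
  obtain ⟨p, hp⟩ : ∃ p, Tendsto y atTop (𝓝 p) := by
    refine cauchySeq_tendsto_of_complete <| cauchySeq_of_le_tendsto_0' (fun n => √(t n / c))
      (fun n k hnk => Real.le_sqrt_of_sq_le (hdist _ _ _ (hy_le le_rfl) (hy_le hnk))) ?_
    simpa using (htlim.div_const c).sqrt
  have hGp (k : ℕ) : G p ≤ ((m + t k : ℝ) : EReal) :=
    (hlsc.isClosed_preimage _).mem_of_tendsto hp <|
      (eventually_ge_atTop k).mono fun n hkn => hy_le hkn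
  have hGp_le : G p ≤ m := by
    refine ge_of_tendsto' (x := atTop) ?_ hGp
    simpa [Function.comp_def] using
      (continuous_coe_real_ereal.tendsto _).comp (htlim.const_add m)
  refine ⟨p, hGp_le, fun q hq => ?_⟩
  have hqp : dist q p ^ 2 ≤ 0 := by
    simpa using hdist q p 0 (by simpa using hq) (by simpa using hGp_le)
  exact dist_eq_zero.1 (pow_eq_zero_iff two_ne_zero |>.1 (hqp.antisymm (sq_nonneg _)))

theorem existsUnique_mem_argmin_of_midpoint_le (hlsc : LowerSemicontinuous G) {B : ℝ}
    (hB : ∀ x, (B : EReal) ≤ G x) {x₀ : X} (hx₀ : G x₀ ≠ ⊤) (hc : 0 < c)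
    (hmid : ∀ (x y : X) (r s : ℝ), G x ≤ r → G y ≤ s →
      ∃ z, G z ≤ (((r + s) / 2 - c * dist x y ^ 2 : ℝ) : EReal)) :
    ∃! p, p ∈ argmin G := by
  obtain ⟨m, hm⟩ : ∃ m : ℝ, (m : EReal) = ⨅ x, G x :=
    EReal.canLift.prf _ ⟨((iInf_le G x₀).trans_lt hx₀.lt_top).ne,
      ((EReal.bot_lt_coe B).trans_le (le_iInf hB)).ne'⟩
  have hargmin (p : X) : p ∈ argmin G ↔ G p ≤ m := by rw [hm, le_iInf_iff]; rfl
  simp only [hargmin]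
  refine existsUnique_le_of_dist_sq_le (c := c) hlsc (fun t ht => ?_) fun x y t hx hy => ?_
  · obtain ⟨y, hy⟩ : ∃ y, G y < ((m + t : ℝ) : EReal) := by
      rw [← iInf_lt_iff, ← hm]
      exact EReal.coe_lt_coe_iff.2 (lt_add_of_pos_right m ht)
    exact ⟨y, hy.le⟩
  · obtain ⟨z, hz⟩ := hmid x y _ _ hx hy
    have hmz := EReal.coe_le_coe_iff.1 ((hm.trans_le (iInf_le G z)).trans hz)
    rw [le_div_iff₀ hc]
    linarith

variable {E : Type*} [NormedAddCommGroup E]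

theorem lowerSemicontinuous_proxObjective {F : E → EReal} (hlsc : LowerSemicontinuous F) (v : E) :
    LowerSemicontinuous (proxObjective F v) := by
  refine hlsc.add' (Continuous.lowerSemicontinuous ?_) fun y =>
    EReal.continuousAt_add (.inr (EReal.coe_ne_bot _)) (.inr (EReal.coe_ne_top _))
  exact continuous_coe_real_ereal.comp (by fun_prop)

/-- Lower semicontinuity bounds `F` from below near a point of its domain, and convexity propagates
the bound with linear growth. -/
theorem exists_sub_mul_norm_le [NormedSpace ℝ E] {F : E → EReal} (hF : IsProper F)
    (hconv : IsConvex F) (hlsc : LowerSemicontinuous F) :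
    ∃ (a K : ℝ) (p : E), ∀ y, ((a - K * ‖y - p‖ : ℝ) : EReal) ≤ F y := by
  obtain ⟨hbot, p, hp⟩ := hF
  obtain ⟨c, hc⟩ : ∃ c : ℝ, (c : EReal) = F p := EReal.canLift.prf _ ⟨hp, hbot p⟩
  have hlt : ((c - 1 : ℝ) : EReal) < F p := by
    rw [← hc]; exact EReal.coe_lt_coe_iff.2 (sub_one_lt c)
  obtain ⟨δ, hδ, hball⟩ := Metric.eventually_nhds_iff_ball.1 (hlsc p _ hlt)
  refine ⟨c - 1, 2 / δ, p, fun y => le_of_not_gt fun hy => ?_⟩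
  set r := ‖y - p‖
  have hr : δ ≤ r := by
    refine le_of_not_gt fun hr => ?_
    refine ((hball y (mem_ball_iff_norm.2 hr)).trans hy).not_ge (EReal.coe_le_coe_iff.2 ?_)
    exact sub_le_self _ (mul_nonneg (by positivity) (norm_nonneg _))
  have hrpos : 0 < r := hδ.trans_le hr
  set t := δ / (2 * r)
  have ht : 0 < t := by positivity
  have ht₁ : t < 1 := by
    rw [div_lt_one (by positivity)]
    linarith
  have hz : (1 - t) • p + t • y ∈ Metric.ball p δ := by
    have hdiff : (1 - t) • p + t • y - p = t • (y - p) := by module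
    have htr : t * r = δ / 2 := by simp only [t]; field_simp
    rw [mem_ball_iff_norm, hdiff, norm_smul_of_nonneg ht.le, htr]
    exact half_lt_self hδ
  have hFz := hconv.le_coe hc.ge hy.le (sub_pos.2 ht₁) ht (sub_add_cancel 1 t)
  refine ((hball _ hz).trans_le hFz).not_ge (EReal.coe_le_coe_iff.2 ?_)
  have htr : t * (2 / δ * r) = 1 := by simp only [t]; field_simp
  linarith

theorem exists_coe_le_proxObjective [NormedSpace ℝ E] {F : E → EReal} (hF : IsProper F)
    (hconv : IsConvex F) (hlsc : LowerSemicontinuous F) (v : E) :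
    ∃ B : ℝ, ∀ y, (B : EReal) ≤ proxObjective F v y := by
  obtain ⟨a, K, p, h⟩ := exists_sub_mul_norm_le hF hconv hlsc
  refine ⟨a - |K| * ‖v - p‖ - K ^ 2 / 2, fun y => ?_⟩
  refine le_trans ?_ (add_le_add_left (h y) _)
  rw [← EReal.coe_add, EReal.coe_le_coe_iff]
  have htri : K * ‖y - p‖ ≤ |K| * (‖y - v‖ + ‖v - p‖) :=
    mul_le_mul (le_abs_self K) (norm_sub_le_norm_sub_add_norm_sub y v p) (norm_nonneg _)
      (abs_nonneg K)
  nlinarith [sq_nonneg (‖y - v‖ - |K|), sq_abs K]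

end Minimization

section Prox

variable {H : Type*} [NormedAddCommGroup H] [InnerProductSpace ℝ H] {F : H → EReal}

theorem proxObjective_midpoint_le (hconv : IsConvex F) (v : H) {x y : H} {r s : ℝ}
    (hx : proxObjective F v x ≤ r) (hy : proxObjective F v y ≤ s) :
    proxObjective F v ((1 / 2 : ℝ) • x + (1 / 2 : ℝ) • y) ≤
      (((r + s) / 2 - 1 / 8 * dist x y ^ 2 : ℝ) : EReal) := by
  rw [proxObjective, add_coe_le_coe_iff] at hx hy ⊢
  refine (hconv.le_coe hx hy one_half_pos one_half_pos (add_halves 1)).trans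
    (EReal.coe_le_coe_iff.2 ?_)
  have hmid : (1 / 2 : ℝ) • x + (1 / 2 : ℝ) • y - v = (1 / 2 : ℝ) • ((x - v) + (y - v)) := by
    module
  have hpar := parallelogram_law_with_norm ℝ (x - v) (y - v)
  rw [sub_sub_sub_cancel_right] at hpar
  rw [hmid, norm_smul_of_nonneg one_half_pos.le, dist_eq_norm]
  linarith

theorem existsUnique_mem_argmin_proxObjective [CompleteSpace H] (hF : IsProper F)
    (hconv : IsConvex F) (hlsc : LowerSemicontinuous F) (v : H) :
    ∃! p, p ∈ argmin (proxObjective F v) := by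
  obtain ⟨B, hB⟩ := exists_coe_le_proxObjective hF hconv hlsc v
  obtain ⟨x₀, hx₀⟩ := hF.2
  exact existsUnique_mem_argmin_of_midpoint_le (lowerSemicontinuous_proxObjective hlsc v) hB
    (EReal.add_ne_top hx₀ (EReal.coe_ne_top _)) (by norm_num) fun x y r s hx hy =>
      ⟨_, proxObjective_midpoint_le hconv v hx hy⟩

theorem prox_eq_iff_mem_argmin [CompleteSpace H] (hF : IsProper F) (hconv : IsConvex F)
    (hlsc : LowerSemicontinuous F) {v p : H} :
    prox F v = p ↔ p ∈ argmin (proxObjective F v) := by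
  have huniq := existsUnique_mem_argmin_proxObjective hF hconv hlsc v
  have hprox : prox F v ∈ argmin (proxObjective F v) := Classical.epsilon_spec huniq.exists
  exact ⟨fun h => h ▸ hprox, fun hp => huniq.unique hprox hp⟩

end Prox

section Subgradient

variable {H : Type*} [NormedAddCommGroup H] [InnerProductSpace ℝ H] {F : H → EReal}

/-- `u` is a subgradient of `F` at `p`, written `u ∈ ∂F(p)` in convex analysis. For proper `F` the
inequality forces `F p` to be finite. -/
def IsSubgradientAt (F : H → EReal) (p u : H) : Prop :=
  ∀ y, F p + (⟪u, y - p⟫ : ℝ) ≤ F y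

theorem isSubgradientAt_coe_mul_iff {c : ℝ} (hc : 0 < c) {p u : H} :
    IsSubgradientAt (fun y => (c : EReal) * F y) p (c • u) ↔ IsSubgradientAt F p u := by
  refine forall_congr' fun y => ?_
  rw [real_inner_smul_left, EReal.coe_mul,
    ← EReal.left_distrib_of_nonneg_of_ne_top (EReal.coe_nonneg.2 hc.le) (EReal.coe_ne_top c),
    coe_mul_le_coe_mul_iff hc]

theorem IsSubgradientAt.ne_top (hF : IsProper F) {p u : H} (hp : IsSubgradientAt F p u) :
    F p ≠ ⊤ := by
  obtain ⟨y, hy⟩ := hF.2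
  exact ne_top_of_add_coe_le (hp y) hy

theorem IsSubgradientAt.inner_sub_nonneg (hF : IsProper F) {p q u v : H}
    (hp : IsSubgradientAt F p u) (hq : IsSubgradientAt F q v) : 0 ≤ ⟪u - v, p - q⟫ := by
  have hpq := hp q
  have hqp := hq p
  lift F p to ℝ using ⟨hp.ne_top hF, hF.1 p⟩ with a
  lift F q to ℝ using ⟨hq.ne_top hF, hF.1 q⟩ with b
  norm_cast at hpq hqp
  rw [← neg_sub p q, inner_neg_right] at hpq
  rw [inner_sub_left]
  linarith

theorem convexOn_half_norm_sub_sq (v : H) :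
    ConvexOn ℝ Set.univ fun y : H => (1 / 2 : ℝ) * ‖y - v‖ ^ 2 := by
  simpa [dist_eq_norm] using
    ((convexOn_univ_dist v).pow (fun _ _ => dist_nonneg) 2).smul one_half_pos.le

variable [CompleteSpace H] {q : H → ℝ} {p u : H}

theorem tendsto_slope_of_hasGradientAt (hq : HasGradientAt q u p) (d : H) :
    Tendsto (fun t : ℝ => t⁻¹ * (q (p + t • d) - q p)) (𝓝[>] 0) (𝓝 ⟪u, d⟫) := by
  simpa using (hq.hasFDerivAt.hasLineDerivAt d).tendsto_slope_zero_right

theorem add_inner_le_of_hasGradientAt (hconv : ConvexOn ℝ Set.univ q) (hq : HasGradientAt q u p)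
    (y : H) : q p + ⟪u, y - p⟫ ≤ q y := by
  suffices ⟪u, y - p⟫ ≤ q y - q p by linarith
  refine le_of_tendsto (tendsto_slope_of_hasGradientAt hq (y - p)) ?_
  filter_upwards [Ioo_mem_nhdsGT one_pos] with t ht
  have hsegment : (1 - t) • p + t • y = p + t • (y - p) := by module
  have hle := hconv.2 (Set.mem_univ p) (Set.mem_univ y) (sub_nonneg.2 ht.2.le) ht.1.le
    (sub_add_cancel 1 t)
  rw [hsegment, smul_eq_mul, smul_eq_mul] at hle
  rw [inv_mul_le_iff₀ ht.1]
  linarith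

theorem isSubgradientAt_neg_of_mem_argmin_add (hF : IsProper F) (hconv : IsConvex F)
    (hq : HasGradientAt q u p) (hp : p ∈ argmin fun y => F y + (q y : EReal)) :
    IsSubgradientAt F p (-u) := by
  have hp_top : F p ≠ ⊤ := by
    obtain ⟨y, hy⟩ := hF.2
    exact ne_top_of_add_coe_le (hp y) (EReal.add_ne_top hy (EReal.coe_ne_top _))
  intro y
  rcases eq_or_ne (F y) ⊤ with hy | hy
  · exact hy ▸ le_top
  obtain ⟨a, ha⟩ : ∃ a : ℝ, (a : EReal) = F p := EReal.canLift.prf _ ⟨hp_top, hF.1 p⟩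
  obtain ⟨s, hs⟩ : ∃ s : ℝ, (s : EReal) = F y := EReal.canLift.prf _ ⟨hy, hF.1 y⟩
  suffices a - s ≤ ⟪u, y - p⟫ by
    rw [← ha, ← hs, ← EReal.coe_add, EReal.coe_le_coe_iff, inner_neg_left]
    linarith
  refine ge_of_tendsto (tendsto_slope_of_hasGradientAt hq (y - p)) ?_
  filter_upwards [Ioo_mem_nhdsGT one_pos] with t ht
  have hsegment : (1 - t) • p + t • y = p + t • (y - p) := by module
  have hF_le := hconv.le_coe ha.ge hs.ge (sub_pos.2 ht.2) ht.1 (sub_add_cancel 1 t)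
  rw [hsegment] at hF_le
  have hmin : a + q p ≤ (1 - t) * a + t * s + q (p + t • (y - p)) := by
    have h : F p + q p ≤ _ := (hp (p + t • (y - p))).trans (add_le_add_left hF_le _)
    rw [← ha] at h
    exact_mod_cast h
  rw [le_inv_mul_iff₀ ht.1]
  linarith

theorem mem_argmin_add_iff_isSubgradientAt (hF : IsProper F) (hconv : IsConvex F)
    (hqconv : ConvexOn ℝ Set.univ q) (hq : HasGradientAt q u p) :
    (p ∈ argmin fun y => F y + (q y : EReal)) ↔ IsSubgradientAt F p (-u) := by
  refine ⟨isSubgradientAt_neg_of_mem_argmin_add hF hconv hq, fun h y => ?_⟩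
  calc F p + (q p : EReal) = F p + (⟪-u, y - p⟫ : ℝ) + ((q p + ⟪u, y - p⟫ : ℝ) : EReal) := by
        rw [add_assoc, ← EReal.coe_add, inner_neg_left]
        congr 2
        ring
    _ ≤ F y + (q y : EReal) := add_le_add (h y)
        (EReal.coe_le_coe_iff.2 (add_inner_le_of_hasGradientAt hqconv hq y))

theorem hasGradientAt_half_norm_sub_sq (v p : H) :
    HasGradientAt (fun y : H => (1 / 2 : ℝ) * ‖y - v‖ ^ 2) (p - v) p := by
  rw [hasGradientAt_iff_hasFDerivAt]
  refine ((((hasFDerivAt_id p).sub_const v).norm_sq).const_mul (1 / 2 : ℝ)).congr_fderiv ?_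
  ext d
  simp

theorem prox_eq_iff_isSubgradientAt (hF : IsProper F) (hconv : IsConvex F)
    (hlsc : LowerSemicontinuous F) {v p : H} :
    prox F v = p ↔ IsSubgradientAt F p (v - p) := by
  rw [prox_eq_iff_mem_argmin hF hconv hlsc, ← neg_sub p v]
  exact mem_argmin_add_iff_isSubgradientAt hF hconv (convexOn_half_norm_sub_sq v)
    (hasGradientAt_half_norm_sub_sq v p)

end Subgradient

section Cocoercivity

variable {H : Type*} [NormedAddCommGroup H] [InnerProductSpace ℝ H] [CompleteSpace H] {g : H → ℝ}

theorem hasDerivAt_comp_add_smul (hg : Differentiable ℝ g) (x d : H) (t : ℝ) :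
    HasDerivAt (fun s : ℝ => g (x + s • d)) ⟪∇ g (x + t • d), d⟫ t := by
  have hline : HasDerivAt (fun s : ℝ => x + s • d) d t := by
    simpa using ((hasDerivAt_id t).smul_const d).const_add x
  exact (hg (x + t • d)).hasGradientAt.hasFDerivAt.comp_hasDerivAt t hline

theorem le_add_inner_gradient_add_sq (hg : Differentiable ℝ g) {L : ℝ}
    (hL : ∀ u v, ‖∇ g u - ∇ g v‖ ≤ L * ‖u - v‖) (x d : H) :
    g (x + d) ≤ g x + ⟪∇ g x, d⟫ + L / 2 * ‖d‖ ^ 2 := by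
  set φ : ℝ → ℝ := fun t => g (x + t • d) - t * ⟪∇ g x, d⟫ - L / 2 * ‖d‖ ^ 2 * t ^ 2
  have hφ (t : ℝ) : HasDerivAt φ
      (⟪∇ g (x + t • d), d⟫ - ⟪∇ g x, d⟫ - L / 2 * ‖d‖ ^ 2 * (2 * t)) t := by
    refine (((hasDerivAt_comp_add_smul hg x d t).sub ((hasDerivAt_id t).mul_const ⟪∇ g x, d⟫)).sub
      ((hasDerivAt_pow 2 t).const_mul (L / 2 * ‖d‖ ^ 2))).congr_deriv ?_
    simp only [one_mul, Nat.cast_ofNat, Nat.add_one_sub_one, pow_one]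
  have hanti : AntitoneOn φ (Set.Icc 0 1) := by
    refine antitoneOn_of_hasDerivWithinAt_nonpos (convex_Icc 0 1)
      (fun t _ => (hφ t).continuousAt.continuousWithinAt)
      (fun t _ => (hφ t).hasDerivWithinAt) fun t ht => ?_
    rw [interior_Icc] at ht
    have hgrad : ‖∇ g (x + t • d) - ∇ g x‖ ≤ L * (t * ‖d‖) := by
      simpa [norm_smul_of_nonneg ht.1.le] using hL (x + t • d) x
    have hinner : ⟪∇ g (x + t • d) - ∇ g x, d⟫ ≤ L * (t * ‖d‖) * ‖d‖ :=
      (real_inner_le_norm _ _).trans (by gcongr)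
    rw [← inner_sub_left]
    linarith
  have h := hanti (Set.left_mem_Icc.2 zero_le_one) (Set.right_mem_Icc.2 zero_le_one) zero_le_one
  simp only [φ, one_smul, zero_smul, add_zero] at h
  linarith

theorem add_inner_gradient_add_sq_le (hconv : ConvexOn ℝ Set.univ g) (hg : Differentiable ℝ g)
    {β : ℝ} (hβ : 0 < β) (hL : ∀ u v, ‖∇ g u - ∇ g v‖ ≤ (1 / β) * ‖u - v‖) (x y : H) :
    g x + ⟪∇ g x, y - x⟫ + β / 2 * ‖∇ g y - ∇ g x‖ ^ 2 ≤ g y := by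
  set e := ∇ g y - ∇ g x
  have hlower : g x + ⟪∇ g x, y + -(β • e) - x⟫ ≤ g (y + -(β • e)) :=
    add_inner_le_of_hasGradientAt hconv (hg x).hasGradientAt _
  have hupper : g (y + -(β • e)) ≤ g y + ⟪∇ g y, -(β • e)⟫ + β / 2 * ‖e‖ ^ 2 := by
    have hnorm : 1 / β / 2 * ‖-(β • e)‖ ^ 2 = β / 2 * ‖e‖ ^ 2 := by
      rw [norm_neg, norm_smul_of_nonneg hβ.le]
      field_simp
    exact hnorm ▸ le_add_inner_gradient_add_sq hg hL y (-(β • e))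
  have hinner : ⟪∇ g y, -(β • e)⟫ - ⟪∇ g x, -(β • e)⟫ = -(β * ‖e‖ ^ 2) := by
    rw [← inner_sub_left, inner_neg_right, real_inner_smul_right, real_inner_self_eq_norm_sq]
  rw [add_sub_right_comm, inner_add_right] at hlower
  linarith

/-- The Baillon–Haddad theorem. -/
theorem mul_norm_gradient_sub_sq_le_inner (hconv : ConvexOn ℝ Set.univ g)
    (hg : Differentiable ℝ g) {β : ℝ} (hβ : 0 < β)
    (hL : ∀ u v, ‖∇ g u - ∇ g v‖ ≤ (1 / β) * ‖u - v‖) (x y : H) :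
    β * ‖∇ g x - ∇ g y‖ ^ 2 ≤ ⟪∇ g x - ∇ g y, x - y⟫ := by
  have hxy := add_inner_gradient_add_sq_le hconv hg hβ hL x y
  have hyx := add_inner_gradient_add_sq_le hconv hg hβ hL y x
  rw [norm_sub_rev, ← neg_sub x y, inner_neg_right] at hxy
  rw [inner_sub_left]
  linarith

end Cocoercivity

section ForwardBackward

variable {H : Type*} [NormedAddCommGroup H] [InnerProductSpace ℝ H]

theorem norm_add_smul_le_of_inner_le {κ : ℝ} (hκ : 0 ≤ κ) {d q : H}
    (h : κ * ‖q‖ ^ 2 + 2 * ⟪q, d⟫ ≤ 0) : ‖d + κ • q‖ ≤ ‖d‖ := by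
  refine le_of_sq_le_sq ?_ (norm_nonneg d)
  rw [norm_add_sq_real, norm_smul_of_nonneg hκ, real_inner_smul_right, real_inner_comm]
  linarith [mul_nonpos_of_nonneg_of_nonpos hκ h]

/-- Here `d` and `e` are the differences of two points and of the gradients of `g` there, and `q` is
the difference of the displacements `T u - u` of the forward-backward operator `T`. -/
theorem mul_norm_sq_add_inner_nonpos {β γ : ℝ} (hβ : 0 < β) (hγ : 0 < γ) {d e q : H}
    (hprox : 0 ≤ ⟪-q - γ • e, d + q⟫) (hgrad : β * ‖e‖ ^ 2 ≤ ⟪e, d⟫) :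
    (4 * β - γ) / (2 * β) * ‖q‖ ^ 2 + 2 * ⟪q, d⟫ ≤ 0 := by
  have hsquare : 0 ≤ ‖q + (2 * β) • e‖ ^ 2 := sq_nonneg _
  rw [norm_add_sq_real, norm_smul_of_nonneg (by positivity), real_inner_smul_right] at hsquare
  rw [inner_sub_left, inner_neg_left, real_inner_smul_left, inner_add_right, inner_add_right,
    real_inner_self_eq_norm_sq, real_inner_comm q e] at hprox
  have hscaled : 0 ≤ γ / (2 * β) * ‖q‖ ^ 2 + 2 * γ * (⟪q, e⟫ + β * ‖e‖ ^ 2) := by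
    refine (mul_nonneg (show 0 ≤ γ / (2 * β) by positivity) hsquare).trans_eq ?_
    field_simp
    ring
  have hκ : (4 * β - γ) / (2 * β) = 2 - γ / (2 * β) := by
    field_simp
    ring
  rw [hκ]
  linarith [mul_le_mul_of_nonneg_left hgrad hγ.le]

variable [CompleteSpace H] {f : H → EReal} {g : H → ℝ} {γ : ℝ}

/-- The forward-backward operator `prox_{γf} ∘ (I - γ∇g)` for the minimization of `f + g`. -/
noncomputable def forwardBackward (f : H → EReal) (g : H → ℝ) (γ : ℝ) (u : H) : H :=
  prox (fun y => (γ : EReal) * f y) (u - γ • ∇ g u)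

theorem forwardBackward_eq_iff (hf : IsProper f) (hfconv : IsConvex f)
    (hflsc : LowerSemicontinuous f) (hγ : 0 < γ) {u p : H} :
    forwardBackward f g γ u = p ↔
      IsSubgradientAt (fun y => (γ : EReal) * f y) p (u - γ • ∇ g u - p) :=
  prox_eq_iff_isSubgradientAt (hf.coe_mul hγ) (hfconv.coe_mul hγ)
    (lowerSemicontinuous_coe_mul hflsc hγ)

theorem isFixedPt_forwardBackward_iff (hf : IsProper f) (hfconv : IsConvex f)
    (hflsc : LowerSemicontinuous f) (hgconv : ConvexOn ℝ Set.univ g) (hγ : 0 < γ) {p : H}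
    (hg : DifferentiableAt ℝ g p) :
    Function.IsFixedPt (forwardBackward f g γ) p ↔ p ∈ argmin fun u => f u + (g u : EReal) := by
  have hstep : p - γ • ∇ g p - p = γ • -∇ g p := by module
  rw [Function.IsFixedPt, forwardBackward_eq_iff hf hfconv hflsc hγ, hstep,
    isSubgradientAt_coe_mul_iff hγ, mem_argmin_add_iff_isSubgradientAt hf hfconv hgconv
      hg.hasGradientAt]

theorem lipschitzWith_relax_forwardBackward (hf : IsProper f) (hfconv : IsConvex f)
    (hflsc : LowerSemicontinuous f) (hgconv : ConvexOn ℝ Set.univ g) (hg : Differentiable ℝ g)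
    {β : ℝ} (hβ : 0 < β) (hL : ∀ u v, ‖∇ g u - ∇ g v‖ ≤ (1 / β) * ‖u - v‖) (hγ : 0 < γ)
    (hγβ : 0 ≤ (4 * β - γ) / (2 * β)) :
    LipschitzWith 1 (relax ((4 * β - γ) / (2 * β)) (forwardBackward f g γ)) := by
  refine LipschitzWith.mk_one fun u v => ?_
  set T := forwardBackward f g γ
  have hsub (w : H) : IsSubgradientAt (fun y => (γ : EReal) * f y) (T w) (w - γ • ∇ g w - T w) :=
    (forwardBackward_eq_iff hf hfconv hflsc hγ).1 rfl
  have hmono := (hsub u).inner_sub_nonneg (hf.coe_mul hγ) (hsub v)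
  have hresolvent : (u - γ • ∇ g u - T u) - (v - γ • ∇ g v - T v) =
      -((T u - u) - (T v - v)) - γ • (∇ g u - ∇ g v) := by module
  have himage : T u - T v = (u - v) + ((T u - u) - (T v - v)) := by abel
  rw [hresolvent, himage] at hmono
  have hrelax (κ : ℝ) : relax κ T u - relax κ T v =
      (u - v) + κ • ((T u - u) - (T v - v)) := by
    simp only [relax]; module
  rw [dist_eq_norm, dist_eq_norm, hrelax]
  exact norm_add_smul_le_of_inner_le hγβ <| mul_norm_sq_add_inner_nonpos hβ hγ hmono
    (mul_norm_gradient_sub_sq_le_inner hgconv hg hβ hL u v)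

end ForwardBackward

end TikhonovFB

theorem corollary3p4_general {H : Type*} [NormedAddCommGroup H] [InnerProductSpace ℝ H]
    [CompleteSpace H]
    (f : H → EReal) (hf_proper : TikhonovFB.IsProper f) (hf_convex : TikhonovFB.IsConvex f)
    (hf_lsc : LowerSemicontinuous f)
    (g : H → ℝ) (hg_convex : ConvexOn ℝ Set.univ g) (hg_diff : Differentiable ℝ g)
    (β : ℝ) (hβ : 0 < β)
    (hg_lip : ∀ u v : H, ‖gradient g u - gradient g v‖ ≤ (1 / β) * ‖u - v‖)
    (hargmin : (TikhonovFB.argmin fun u => f u + (g u : EReal)).Nonempty)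
    (γ : ℝ) (hγ_pos : 0 < γ)
    (b lam : ℕ → ℝ)
    (hb_mem : ∀ n, b n ∈ Set.Icc 0 1)
    (hb_lim : Tendsto b atTop (𝓝 1))
    (hb_div : Tendsto (fun N => ∑ n ∈ Finset.range N, (1 - b n)) atTop atTop)
    (hb_var : Summable fun n => |b (n + 1) - b n|)
    (hlam_mem : ∀ n, lam n ∈ Set.Icc 0 ((4 * β - γ) / (2 * β)))
    (hlam_liminf : 0 < liminf lam atTop)
    (hlam_var : Summable fun n => |lam (n + 1) - lam n|)
    (x : ℕ → H)
    (hx : ∀ n, x (n + 1) = ((1 - lam n) * b n) • x n +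
      lam n • TikhonovFB.prox (fun u => (γ : EReal) * f u)
        (b n • x n - γ • gradient g (b n • x n))) :
    (∀ v : H, ∃! p : H, p ∈ TikhonovFB.argmin
      (TikhonovFB.proxObjective (fun u => (γ : EReal) * f u) v)) ∧
    ∃ xbar ∈ TikhonovFB.argmin (fun u => f u + (g u : EReal)),
      (∀ z ∈ TikhonovFB.argmin (fun u => f u + (g u : EReal)), z ≠ xbar → ‖xbar‖ < ‖z‖) ∧
      Tendsto x atTop (𝓝 xbar) := by
  refine ⟨TikhonovFB.existsUnique_mem_argmin_proxObjective (hf_proper.coe_mul hγ_pos)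
    (hf_convex.coe_mul hγ_pos) (TikhonovFB.lowerSemicontinuous_coe_mul hf_lsc hγ_pos), ?_⟩
  have hfix (p : H) : Function.IsFixedPt (TikhonovFB.forwardBackward f g γ) p ↔
      p ∈ TikhonovFB.argmin fun u => f u + (g u : EReal) :=
    TikhonovFB.isFixedPt_forwardBackward_iff hf_proper hf_convex hf_lsc hg_convex hγ_pos (hg_diff p)
  have hlip := TikhonovFB.lipschitzWith_relax_forwardBackward hf_proper hf_convex hf_lsc hg_convex
    hg_diff hβ hg_lip hγ_pos ((hlam_mem 0).1.trans (hlam_mem 0).2)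
  have hx_relax (n : ℕ) :
      x (n + 1) = TikhonovFB.relax (lam n) (TikhonovFB.forwardBackward f g γ) (b n • x n) := by
    rw [hx, TikhonovFB.relax, TikhonovFB.forwardBackward]; module
  obtain ⟨p, hp⟩ := hargmin
  obtain ⟨xbar, hxbar, hmin, hlim⟩ := TikhonovFB.exists_minNorm_isFixedPt_tendsto_of_averaged
    hlip ((hfix p).2 hp) hb_mem hb_lim hb_div hb_var hlam_mem hlam_liminf hlam_var hx_relax
  exact ⟨xbar, (hfix xbar).1 hxbar, fun z hz => hmin z ((hfix z).2 hz), hlim⟩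

theorem corollary3p4 {H : Type*} [NormedAddCommGroup H] [InnerProductSpace ℝ H] [CompleteSpace H]
    (f : H → EReal) (hf_proper : TikhonovFB.IsProper f) (hf_convex : TikhonovFB.IsConvex f)
    (hf_lsc : LowerSemicontinuous f)
    (g : H → ℝ) (hg_convex : ConvexOn ℝ Set.univ g) (hg_diff : Differentiable ℝ g)
    (β : ℝ) (hβ : 0 < β)
    (hg_lip : ∀ u v : H, ‖gradient g u - gradient g v‖ ≤ (1 / β) * ‖u - v‖)
    (hargmin : (TikhonovFB.argmin fun u => f u + (g u : EReal)).Nonempty)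
    (γ : ℝ) (hγ_pos : 0 < γ) (hγ_le : γ ≤ 2 * β)
    (b lam : ℕ → ℝ)
    (hb_mem : ∀ n, 0 < b n ∧ b n ≤ 1)
    (hb_lim : Tendsto b atTop (𝓝 1))
    (hb_div : Tendsto (fun N => ∑ n ∈ Finset.range N, (1 - b n)) atTop atTop)
    (hb_var : Summable fun n => |b (n + 1) - b n|)
    (hlam_mem : ∀ n, 0 < lam n ∧ lam n ≤ (4 * β - γ) / (2 * β))
    (hlam_liminf : 0 < liminf lam atTop)
    (hlam_var : Summable fun n => |lam (n + 1) - lam n|)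
    (x : ℕ → H)
    (hx : ∀ n, x (n + 1) = ((1 - lam n) * b n) • x n +
      lam n • TikhonovFB.prox (fun u => (γ : EReal) * f u)
        (b n • x n - γ • gradient g (b n • x n))) :
    (∀ v : H, ∃! p : H, p ∈ TikhonovFB.argmin
      (TikhonovFB.proxObjective (fun u => (γ : EReal) * f u) v)) ∧
    ∃ xbar ∈ TikhonovFB.argmin (fun u => f u + (g u : EReal)),
      (∀ z ∈ TikhonovFB.argmin (fun u => f u + (g u : EReal)), z ≠ xbar → ‖xbar‖ < ‖z‖) ∧
      Tendsto x atTop (𝓝 xbar) :=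
  corollary3p4_general f hf_proper hf_convex hf_lsc g hg_convex hg_diff β hβ hg_lip hargmin γ hγ_pos
    b lam (fun n => ⟨(hb_mem n).1.le, (hb_mem n).2⟩) hb_lim hb_div hb_var
    (fun n => ⟨(hlam_mem n).1.le, (hlam_mem n).2⟩) hlam_liminf hlam_var x hx
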